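/- **Setting.** Consider an infinite-horizon discounted Markov decision process with measurable state space $\mathcal S$ and action space $\mathcal A$, initial law $\rho_0$, discount $\gamma\in[0,1)$, in which taking action $a_t$ in state $s_t$ produces a (possibly random) real reward $r_t$ and a next state $s_{t+1}$ whose joint law depends only on $(s_t,a_t)$. Let $\pi_\theta(a\mid s)$, $\theta\in\mathbb R^d$, be policies given by densities with respect to an s-finite reference measure on $\mathcal A$; fix $\theta$, write $\pi=\pi_\theta$, and let $u_\theta(s,a)=\nabla_\theta\log\pi_\theta(a\mid s)$. Let $\tau=(s_0,a_0,r_0,s_1,a_1,r_1,\dots)$ be the trajectory with $s_0\sim\rho_0$, $a_n\sim\pi(\cdot\mid s_n)$. Put $$V^\pi(s)=\mathbb E\Big[\sum_{l\ge0}\gamma^l r_l\,\Big|\,s_0=s\Big],\qquad Q^\pi(s,a)=\mathbb E\Big[\sum_{l\ge0}\gamma^l r_l\,\Big|\,s_0=s,a_0=a\Big].$$ For a random vector $X$ let $\mathbb V[X]=\mathbb E\|X-\mathbb E X\|_2^2\in[0,\infty]$ (it is $+\infty$ if $X$ is not square integrable); all variances below are over the trajectory $\tau$, in particular over $(s_t,a_t)$.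 For $\lambda\in[0,1]$, a time $t$, a bootstrapped value $\Psi_n=\Psi(s_n,a_n)$ and a state-dependent baseline $b_n=b(s_n)$, let $\delta_n=r_n+\gamma\Psi_{n+1}-b_n$, $z_n=\Psi_n-b_n$, $\delta^{V^\pi}_n=r_n+\gamma V^\pi(s_{n+1})-V^\pi(s_n)$, and $$A_t^{\mathrm{UAE}(\gamma,\lambda)}=\delta_t+\sum_{l\ge1}(\gamma\lambda)^l(\delta_{t+l}-z_{t+l}),\qquad A_t^{\mathrm{GAE}(\gamma,\lambda)}=\sum_{l\ge0}(\gamma\lambda)^l\,\delta^{V^\pi}_{t+l}.$$ **Assumptions.** $\mathbb E[\sum_{l}\gamma^l|r_l|\mid s_0=s]<\infty$ for every $s$; the series defining $A_t^{\mathrm{GAE}(\gamma,\lambda)}$ converges absolutely almost surely; $\theta'\mapsto\log\pi_{\theta'}(a_t\mid s_t)$ is differentiable at $\theta$ almost surely; $u_\theta$ and $b$ are measurable. **Statement.** Take $\Psi=V^\pi$, and let $b$ be any baseline that reduces the variance of the policy gradient at least as much as $V^\pi$ does, i.e. $$\mathbb V_{s_t,a_t}\big[u_\theta(s_t,a_t)\,(Q^\pi(s_t,a_t)-b(s_t))\big]\le\mathbb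 V_{s_t,a_t}\big[u_\theta(s_t,a_t)\,(Q^\pi(s_t,a_t)-V^\pi(s_t))\big].$$ Then $$\mathbb V\big[u_\theta(s_t,a_t)\,A_t^{\mathrm{UAE}(\gamma,\lambda)}\big]\le\mathbb V\big[u_\theta(s_t,a_t)\,A_t^{\mathrm{GAE}(\gamma,\lambda)}\big].$$ -/

import Mathlib

open MeasureTheory ProbabilityTheory
open scoped ENNReal

/-- A discounted infinite-horizon Markov decision process with measurable state space `S` and
measurable action space `A`. `step (s, a)` is the joint law of the reward emitted and of the next
state when action `a` is taken in state `s`; its second marginal is the transition law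
`P(· | s, a)`. A deterministic reward `r(s, a)` is the case of a Dirac first marginal. -/
structure MDP (S A : Type*) [MeasurableSpace S] [MeasurableSpace A] where
  /-- law of the initial state -/
  init : Measure S
  init_prob : IsProbabilityMeasure init
  /-- joint law of (reward, next state) given (state, action) -/
  step : Kernel (S × A) (ℝ × S)
  step_markov : IsMarkovKernel step
  /-- the discount factor -/
  γ : ℝ
  γ_nonneg : 0 ≤ γ
  γ_lt_one : γ < 1

attribute [instance] MDP.init_prob MDP.step_markov

/-- A family of stochastic policies with parameter `θ ∈ ℝᵈ`, given by densities
`density θ s a = π_θ(a | s)` with respect to a reference measure `ν` on the actions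
(counting measure for discrete actions, Lebesgue measure for continuous ones). -/
structure ParamPolicy (d : ℕ) (S A : Type*) [MeasurableSpace S] [MeasurableSpace A]
    (ν : Measure A) where
  density : EuclideanSpace ℝ (Fin d) → S → A → ℝ
  density_nonneg : ∀ θ s a, 0 ≤ density θ s a
  density_measurable : ∀ θ, Measurable (fun x : S × A => density θ x.1 x.2)
  density_lintegral : ∀ θ s, ∫⁻ a, ENNReal.ofReal (density θ s a) ∂ν = 1

namespace ParamPolicy

variable {d : ℕ} {S A : Type*} [MeasurableSpace S] [MeasurableSpace A] {ν : Measure A} [SFinite ν]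

/-- The policy `π_θ` as a kernel: `π_θ(da | s) = π_θ(a | s) ν(da)`. -/
noncomputable def kernel (π : ParamPolicy d S A ν) (θ : EuclideanSpace ℝ (Fin d)) : Kernel S A :=
  Kernel.withDensity (Kernel.const S ν) (fun s a => ENNReal.ofReal (π.density θ s a))

theorem kernel_apply (π : ParamPolicy d S A ν) (θ : EuclideanSpace ℝ (Fin d)) (s : S) :
    π.kernel θ s = ν.withDensity (fun a => ENNReal.ofReal (π.density θ s a)) := by
  have h : Measurable (Function.uncurry fun s a => ENNReal.ofReal (π.density θ s a)) :=
    (π.density_measurable θ).ennreal_ofReal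
  rw [kernel, Kernel.withDensity_apply _ h, Kernel.const_apply]

instance (π : ParamPolicy d S A ν) (θ : EuclideanSpace ℝ (Fin d)) :
    IsMarkovKernel (π.kernel θ) := by
  refine ⟨fun s => ⟨?_⟩⟩
  rw [kernel_apply, withDensity_apply _ MeasurableSet.univ, Measure.restrict_univ,
    π.density_lintegral]

/-- The score `u_θ(s, a) = ∇_θ log π_θ(a | s)`. -/
noncomputable def score (π : ParamPolicy d S A ν) (θ : EuclideanSpace ℝ (Fin d)) (s : S) (a : A) :
    EuclideanSpace ℝ (Fin d) :=
  gradient (fun ϑ => Real.log (π.density ϑ s a)) θ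

end ParamPolicy

/-- A trajectory. The entry `ω n = ((r_{n-1}, s_n), a_n)` records the reward emitted just before
time `n`, the state and the action at time `n`; the reward component of `ω 0` is unused. -/
abbrev Traj (S A : Type*) := ℕ → (ℝ × S) × A

namespace Traj

variable {S A : Type*}

/-- The state `s_t`. -/
def state (ω : Traj S A) (t : ℕ) : S := (ω t).1.2

/-- The action `a_t`. -/
def action (ω : Traj S A) (t : ℕ) : A := (ω t).2

/-- The reward `r_t`, emitted after the action `a_t`. -/
def reward (ω : Traj S A) (t : ℕ) : ℝ := (ω (t + 1)).1.1

end Traj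

namespace MDP

variable {S A : Type*} [MeasurableSpace S] [MeasurableSpace A]

/-- One step of the trajectory under the policy `κ`: from `(s_n, a_n)` draw
`(r_n, s_{n+1}) ∼ step (s_n, a_n)` and then `a_{n+1} ∼ κ(· | s_{n+1})`. -/
noncomputable def chain (M : MDP S A) (κ : Kernel S A) [IsMarkovKernel κ] :
    Kernel ((ℝ × S) × A) ((ℝ × S) × A) :=
  (M.step ⊗ₖ Kernel.prodMkLeft (S × A) (κ.comap Prod.snd measurable_snd)).comap
    (fun y => (y.1.2, y.2)) (by fun_prop)

instance (M : MDP S A) (κ : Kernel S A) [IsMarkovKernel κ] : IsMarkovKernel (M.chain κ) := by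
  unfold chain; infer_instance

/-- The law of the trajectory under the policy `κ` when `(s_0, a_0)` has law `m`. -/
noncomputable def trajLaw (M : MDP S A) (κ : Kernel S A) [IsMarkovKernel κ]
    (m : Measure (S × A)) : Measure (Traj S A) :=
  Kernel.trajMeasure (X := fun _ => (ℝ × S) × A)
    (m.map (fun x => ((0, x.1), x.2)))
    (fun n => (M.chain κ).comap
      (fun h : (i : Finset.Iic n) → (ℝ × S) × A => h ⟨n, Finset.mem_Iic.2 le_rfl⟩)
      (measurable_pi_apply _))

instance (M : MDP S A) (κ : Kernel S A) [IsMarkovKernel κ] (m : Measure (S × A))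
    [IsProbabilityMeasure m] : IsProbabilityMeasure (M.trajLaw κ m) := by
  have : IsProbabilityMeasure (m.map (fun x : S × A => (((0 : ℝ), x.1), x.2))) :=
    Measure.isProbabilityMeasure_map (by fun_prop)
  unfold trajLaw; infer_instance

/-- The law of the trajectory with `s_0 ∼ μ` and `a_0 ∼ κ(· | s_0)`. -/
noncomputable def trajLawFrom (M : MDP S A) (κ : Kernel S A) [IsMarkovKernel κ]
    (μ : Measure S) : Measure (Traj S A) :=
  M.trajLaw κ (μ ⊗ₘ κ)

/-- The discounted return `∑ₗ γˡ rₗ`. -/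
noncomputable def discountedReturn (M : MDP S A) (ω : Traj S A) : ℝ :=
  ∑' l : ℕ, M.γ ^ l * ω.reward l

/-- `Q^π(s, a)`, the expected return given `s_0 = s`, `a_0 = a`. -/
noncomputable def Q (M : MDP S A) (κ : Kernel S A) [IsMarkovKernel κ] (s : S) (a : A) : ℝ :=
  ∫ ω, M.discountedReturn ω ∂(M.trajLaw κ (Measure.dirac (s, a)))

/-- `V^π(s)`, the expected return given `s_0 = s`. -/
noncomputable def V (M : MDP S A) (κ : Kernel S A) [IsMarkovKernel κ] (s : S) : ℝ :=
  ∫ ω, M.discountedReturn ω ∂(M.trajLawFrom κ (Measure.dirac s))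

end MDP

section Estimators

variable {S A : Type*}

/-- The residual `δ_t^V = r_t + γ V(s_{t+1}) - V(s_t)`. -/
def valueResidual (γ : ℝ) (V : S → ℝ) (ω : Traj S A) (t : ℕ) : ℝ :=
  ω.reward t + γ * V (ω.state (t + 1)) - V (ω.state t)

/-- The estimator `GAE(γ, lam)` at time `t`: `∑_{l ≥ 0} (γ lam)ˡ δ_{t+l}^V`. -/
noncomputable def gae (γ lam : ℝ) (V : S → ℝ) (t : ℕ) (ω : Traj S A) : ℝ :=
  ∑' l : ℕ, (γ * lam) ^ l * valueResidual γ V ω (t + l)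

/-- The residual `δ_t = r_t + γ Ψ_{t+1} - b(s_t)` with `Ψ_t = Ψ(s_t, a_t)`. -/
def baseResidual (γ : ℝ) (Ψ : S → A → ℝ) (b : S → ℝ) (ω : Traj S A) (t : ℕ) : ℝ :=
  ω.reward t + γ * Ψ (ω.state (t + 1)) (ω.action (t + 1)) - b (ω.state t)

/-- The correction `z_t = Ψ_t - b(s_t)`. -/
def correction (Ψ : S → A → ℝ) (b : S → ℝ) (ω : Traj S A) (t : ℕ) : ℝ :=
  Ψ (ω.state t) (ω.action t) - b (ω.state t)

/-- The estimator `UAE(γ, lam)` at time `t`, with bootstrapped value `Ψ` and baseline `b`: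
`δ_t + ∑_{l ≥ 1} (γ lam)ˡ (δ_{t+l} - z_{t+l})`. -/
noncomputable def uae (γ lam : ℝ) (Ψ : S → A → ℝ) (b : S → ℝ) (t : ℕ) (ω : Traj S A) : ℝ :=
  baseResidual γ Ψ b ω t +
    ∑' l : ℕ, (γ * lam) ^ (l + 1) *
      (baseResidual γ Ψ b ω (t + (l + 1)) - correction Ψ b ω (t + (l + 1)))

end Estimators

/-- The `ℓ²`-norm variance `E ‖X - E X‖²` of a random vector, with values in `[0, ∞]`
(for a measurable `X` it is finite exactly when `X` is square integrable). -/
noncomputable def vecVariance {Ω E : Type*} [MeasurableSpace Ω] [NormedAddCommGroup E]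
    [NormedSpace ℝ E] (X : Ω → E) (P : Measure Ω) : ℝ≥0∞ :=
  ∫⁻ ω, ‖X ω - ∫ ω', X ω' ∂P‖ₑ ^ 2 ∂P

/-! ### Uniqueness of the Ionescu-Tulcea measure. -/

section TrajMeasure

variable {Y : Type*} [MeasurableSpace Y]

/-! Condition on x = (s_t, a_t). With Ψ = V^π each corrected residual δ - z equals δ^V, so UAE is
GAE plus V^π(s_t) - b(s_t), a function of x (`uae_value_eq_gae_add`). GAE has conditional mean Q^π -
V^π (`integral_gae`), hence UAE has conditional mean Q^π - b, and both have the same conditional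
variance. The law of total variance (`vecVariance_smul_comp`) splits the variance of u·A into E[‖u‖²
Var(A | x)] plus the variance of u·E[A | x]. The first terms agree for the two estimators, and the
second are exactly the two sides of the baseline hypothesis.

Time t is reduced to time 0 by the Markov property: the trajectory seen from time t is again a
trajectory of the process, started from some state law μ (`trajLawFrom_map_iterate_shift`).

The analytic work is the conditional mean of GAE. For lam < 1 the series may be integrated term by
term, and the discounted residuals after the first have mean zero. For lam = 1 the partial sums
telescope, and the boundary term γ^K V(s_K) tends to 0 in L¹ because it is dominated by the tail of
the absolute return. No square integrability is needed: all variances live in [0, ∞]. -/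

theorem MeasureTheory.Measure.compProd_comap_map_prodMap_id {α β γ : Type*} [MeasurableSpace α]
    [MeasurableSpace β] [MeasurableSpace γ] (μ : Measure α) [IsFiniteMeasure μ] (κ : Kernel β γ)
    [IsMarkovKernel κ] {g : α → β} (hg : Measurable g) :
    (μ ⊗ₘ κ.comap g hg).map (Prod.map g id) = μ.map g ⊗ₘ κ := by
  ext s hs
  rw [Measure.map_apply (by fun_prop) hs, Measure.compProd_apply (hs.preimage (by fun_prop)),
    Measure.compProd_apply hs, lintegral_map (Kernel.measurable_kernel_prodMk_left hs) hg]
  rfl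

/-- A probability measure on trajectories with the right initial law and the right one-step
conditional laws is the Ionescu-Tulcea measure. -/
theorem eq_trajMeasure {μ₀ : Measure Y} [IsProbabilityMeasure μ₀]
    (κ : (n : ℕ) → Kernel ((i : Finset.Iic n) → Y) Y) [∀ n, IsMarkovKernel (κ n)]
    (ρ : Measure (ℕ → Y)) [IsProbabilityMeasure ρ] (h0 : ρ.map (fun x => x 0) = μ₀)
    (hstep : ∀ n, ρ.map (fun x => (Preorder.frestrictLe n x, x (n + 1))) =
      ρ.map (Preorder.frestrictLe n) ⊗ₘ κ n) :
    ρ = Kernel.trajMeasure (X := fun _ => Y) μ₀ κ := by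
  set ρ' := Kernel.trajMeasure (X := fun _ => Y) μ₀ κ
  have hinit : ρ'.map (Preorder.frestrictLe (π := fun _ => Y) 0) =
      μ₀.map (MeasurableEquiv.piUnique (fun _ : Finset.Iic 0 => Y)).symm := by
    simp only [ρ', Kernel.trajMeasure]
    rw [Measure.map_comp _ _ (by fun_prop), Kernel.traj_map_frestrictLe, Kernel.partialTraj_self,
      Measure.id_comp]
  have key : ∀ n, ρ.map (Preorder.frestrictLe (π := fun _ => Y) n) =
      ρ'.map (Preorder.frestrictLe n) := by
    intro n
    induction n with
    | zero =>
      rw [hinit, ← h0, Measure.map_map (by fun_prop) (by fun_prop)]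
      congr 1
      funext x i
      obtain ⟨i, hi⟩ := i
      obtain rfl : i = 0 := by simpa using hi
      rfl
    | succ n ih =>
      -- `F` appends one coordinate to a history, so the marginal up to n + 1 is determined by the
      -- marginal up to n and the one-step kernel.
      let F : ((i : Finset.Iic n) → Y) × Y → ((i : Finset.Iic (n + 1)) → Y) :=
        fun p i => if h : i.1 ≤ n then p.1 ⟨i.1, Finset.mem_Iic.2 h⟩ else p.2
      have hF : Measurable F := by
        refine measurable_pi_iff.2 fun i => ?_
        by_cases h : i.1 ≤ n
        · simp only [F, h, dite_true]; fun_prop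
        · simp only [F, h, dite_false]; fun_prop
      have hFr : (Preorder.frestrictLe (π := fun _ => Y) (n + 1)) =
          F ∘ (fun x => (Preorder.frestrictLe n x, x (n + 1))) := by
        funext x i
        obtain ⟨i, hi⟩ := i
        by_cases h : i ≤ n
        · simp [F, h]
        · obtain rfl : i = n + 1 := by have := Finset.mem_Iic.1 hi; omega
          simp [F]
      rw [hFr, ← Measure.map_map hF (by fun_prop), ← Measure.map_map hF (by fun_prop), hstep, ih,
        Kernel.map_frestrictLe_trajMeasure_compProd_eq_map_trajMeasure]
  have hlim : IsProjectiveLimit (α := fun _ : ℕ => Y) ρ (fun I => ρ'.map I.restrict) := by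
    intro I
    obtain ⟨n, hn⟩ : ∃ n, I ⊆ Finset.Iic n :=
      ⟨I.sup id, fun i hi => Finset.mem_Iic.2 (Finset.le_sup (f := id) hi)⟩
    have h : Finset.restrict (π := fun _ => Y) I =
      (fun (z : (i : Finset.Iic n) → Y) (i : I) => z ⟨i.1, hn i.2⟩) ∘
        Preorder.frestrictLe n := rfl
    simp only [h]
    rw [← Measure.map_map (by fun_prop) (by fun_prop), key,
      Measure.map_map (by fun_prop) (by fun_prop)]
  have : ∀ I : Finset ℕ, IsFiniteMeasure (ρ'.map (I.restrict (π := fun _ => Y))) := fun I => by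
    infer_instance
  exact hlim.unique (fun I => rfl)

end TrajMeasure

/-! ### The time shift on trajectories. -/

namespace Traj

variable {S A : Type*}

/-- The state-action pair at time `t`. -/
def pair (ω : Traj S A) (t : ℕ) : S × A := (ω.state t, ω.action t)

/-- The trajectory seen from time `1` on, with the unused initial reward reset to `0`. -/
def shift (ω : Traj S A) : Traj S A
  | 0 => ((0, ω.state 1), ω.action 1)
  | n + 1 => ω (n + 2)

theorem shift_state (ω : Traj S A) (n : ℕ) : ω.shift.state n = ω.state (n + 1) := by
  cases n <;> rfl

theorem shift_action (ω : Traj S A) (n : ℕ) : ω.shift.action n = ω.action (n + 1) := by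
  cases n <;> rfl

theorem shift_reward (ω : Traj S A) (n : ℕ) : ω.shift.reward n = ω.reward (n + 1) := rfl

theorem iterate_shift_state (ω : Traj S A) (t n : ℕ) :
    (shift^[t] ω).state n = ω.state (t + n) := by
  induction t generalizing n with
  | zero => simp
  | succ t ih => rw [Function.iterate_succ_apply', shift_state, ih]; congr 1; omega

theorem iterate_shift_action (ω : Traj S A) (t n : ℕ) :
    (shift^[t] ω).action n = ω.action (t + n) := by
  induction t generalizing n with
  | zero => simp
  | succ t ih => rw [Function.iterate_succ_apply', shift_action, ih]; congr 1; omega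

theorem iterate_shift_reward (ω : Traj S A) (t n : ℕ) :
    (shift^[t] ω).reward n = ω.reward (t + n) := by
  induction t generalizing n with
  | zero => simp
  | succ t ih => rw [Function.iterate_succ_apply', shift_reward, ih]; congr 1; omega

variable [MeasurableSpace S] [MeasurableSpace A]

@[fun_prop]
theorem measurable_state (t : ℕ) : Measurable fun ω : Traj S A => ω.state t := by
  unfold state; fun_prop

@[fun_prop]
theorem measurable_action (t : ℕ) : Measurable fun ω : Traj S A => ω.action t := by
  unfold action; fun_prop

@[fun_prop]
theorem measurable_reward (t : ℕ) : Measurable fun ω : Traj S A => ω.reward t := by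
  unfold reward; fun_prop

@[fun_prop]
theorem measurable_pair (t : ℕ) : Measurable fun ω : Traj S A => ω.pair t := by
  unfold pair; fun_prop

@[fun_prop]
theorem measurable_shift : Measurable (shift : Traj S A → Traj S A) := by
  refine measurable_pi_iff.2 fun n => ?_
  cases n with
  | zero => simp only [shift]; fun_prop
  | succ n => simp only [shift]; fun_prop

end Traj

/-! ### The Markov property of the trajectory law. -/

namespace MDP

variable {S A : Type*} [MeasurableSpace S] [MeasurableSpace A]

/-- The kernel that draws a trajectory from its initial state-action pair. -/
noncomputable def trajKernel (M : MDP S A) (κ : Kernel S A) [IsMarkovKernel κ] :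
    Kernel (S × A) (Traj S A) :=
  (Kernel.traj (X := fun _ => (ℝ × S) × A) (fun n => (M.chain κ).comap
      (fun h : (i : Finset.Iic n) → (ℝ × S) × A => h ⟨n, Finset.mem_Iic.2 le_rfl⟩)
      (measurable_pi_apply _)) 0).comap (fun x _ => ((0, x.1), x.2)) (by fun_prop)

instance (M : MDP S A) (κ : Kernel S A) [IsMarkovKernel κ] : IsMarkovKernel (M.trajKernel κ) := by
  unfold trajKernel; infer_instance

/-- The transition kernel of the state-action chain. -/
noncomputable def pairKernel (M : MDP S A) (κ : Kernel S A) [IsMarkovKernel κ] :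
    Kernel (S × A) (S × A) :=
  (M.step ⊗ₖ Kernel.prodMkLeft (S × A) (κ.comap Prod.snd measurable_snd)).map
    (fun z => (z.1.2, z.2))

instance (M : MDP S A) (κ : Kernel S A) [IsMarkovKernel κ] : IsMarkovKernel (M.pairKernel κ) := by
  unfold pairKernel; exact Kernel.IsMarkovKernel.map _ (by fun_prop)

theorem trajLaw_eq_comp (M : MDP S A) (κ : Kernel S A) [IsMarkovKernel κ] (m : Measure (S × A)) :
    M.trajLaw κ m = M.trajKernel κ ∘ₘ m := by
  ext s hs
  rw [trajLaw, Kernel.trajMeasure, Measure.map_map (by fun_prop) (by fun_prop),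
    Measure.bind_apply hs (Kernel.aemeasurable _), Measure.bind_apply hs (Kernel.aemeasurable _),
    lintegral_map (Kernel.measurable_coe _ hs) (by fun_prop)]
  rfl

theorem trajLaw_dirac (M : MDP S A) (κ : Kernel S A) [IsMarkovKernel κ] (x : S × A) :
    M.trajLaw κ (Measure.dirac x) = M.trajKernel κ x := by
  rw [trajLaw_eq_comp, Measure.dirac_bind (Kernel.measurable _)]

theorem trajLaw_map_zero (M : MDP S A) (κ : Kernel S A) [IsMarkovKernel κ] (m : Measure (S × A))
    [IsProbabilityMeasure m] :
    (M.trajLaw κ m).map (Preorder.frestrictLe (π := fun _ => (ℝ × S) × A) 0) =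
      m.map (fun x _ => ((0, x.1), x.2)) := by
  rw [trajLaw, Kernel.trajMeasure, Measure.map_comp _ _ (by fun_prop),
    Kernel.traj_map_frestrictLe, Kernel.partialTraj_self, Measure.id_comp,
    Measure.map_map (by fun_prop) (by fun_prop)]
  rfl

theorem trajLaw_map_pair_zero (M : MDP S A) (κ : Kernel S A) [IsMarkovKernel κ]
    (m : Measure (S × A)) [IsProbabilityMeasure m] :
    (M.trajLaw κ m).map (fun ω => ω.pair 0) = m := by
  have h : (fun ω : Traj S A => ω.pair 0) =
      (fun h : (i : Finset.Iic 0) → (ℝ × S) × A => ((h ⟨0, by simp⟩).1.2, (h ⟨0, by simp⟩).2)) ∘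
        Preorder.frestrictLe 0 := rfl
  rw [h, ← Measure.map_map (by fun_prop) (by fun_prop), trajLaw_map_zero,
    Measure.map_map (by fun_prop) (by fun_prop)]
  exact Measure.map_id

theorem trajLaw_map_shift (M : MDP S A) (κ : Kernel S A) [IsMarkovKernel κ] (m : Measure (S × A))
    [IsProbabilityMeasure m] :
    (M.trajLaw κ m).map Traj.shift = M.trajLaw κ (M.pairKernel κ ∘ₘ m) := by
  have : IsProbabilityMeasure ((M.trajLaw κ m).map Traj.shift) :=
    Measure.isProbabilityMeasure_map (by fun_prop)
  have : IsProbabilityMeasure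
      ((M.pairKernel κ ∘ₘ m).map (fun x : S × A => (((0 : ℝ), x.1), x.2))) :=
    Measure.isProbabilityMeasure_map (by fun_prop)
  have : IsProbabilityMeasure (m.map (fun x : S × A => (((0 : ℝ), x.1), x.2))) :=
    Measure.isProbabilityMeasure_map (by fun_prop)
  have hstep : ∀ n : ℕ, (M.trajLaw κ m).map (fun x => (Preorder.frestrictLe n x, x (n + 1))) =
      (M.trajLaw κ m).map (Preorder.frestrictLe n) ⊗ₘ (M.chain κ).comap
        (fun h : (i : Finset.Iic n) → (ℝ × S) × A => h ⟨n, Finset.mem_Iic.2 le_rfl⟩)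
        (measurable_pi_apply _) :=
    fun n => Kernel.map_frestrictLe_trajMeasure_compProd_eq_map_trajMeasure.symm
  apply eq_trajMeasure
  · have h1 := congrArg (fun μ => Measure.map (fun z => (((0 : ℝ), z.1.2), z.2)) (Measure.snd μ))
      (hstep 0)
    rw [Measure.snd_map_prodMk (by fun_prop), Measure.map_map (by fun_prop) (by fun_prop),
      Measure.snd_compProd] at h1
    rw [Measure.map_map (by fun_prop) (by fun_prop)]
    refine h1.trans ?_
    change Measure.map _ (_ ∘ₘ (M.trajLaw κ m).map (Preorder.frestrictLe 0)) = _
    rw [trajLaw_map_zero]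
    ext s hs
    rw [Measure.map_apply (by fun_prop) hs, Measure.map_apply (by fun_prop) hs,
      Measure.bind_apply (hs.preimage (by fun_prop)) (Kernel.aemeasurable _),
      Measure.bind_apply (hs.preimage (by fun_prop)) (Kernel.aemeasurable _),
      lintegral_map (Kernel.measurable_coe _ (hs.preimage (by fun_prop))) (by fun_prop)]
    refine lintegral_congr fun x => ?_
    rw [pairKernel, Kernel.map_apply' _ (by fun_prop) _ (hs.preimage (by fun_prop))]
    rfl
  · intro n
    let G : ((i : Finset.Iic (n + 1)) → (ℝ × S) × A) → ((i : Finset.Iic n) → (ℝ × S) × A) :=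
      fun h i => if i.1 = 0 then ((0, (h ⟨1, by simp⟩).1.2), (h ⟨1, by simp⟩).2)
        else h ⟨i.1 + 1, Finset.mem_Iic.2 (Nat.succ_le_succ (Finset.mem_Iic.1 i.2))⟩
    have hG : Measurable G := by
      refine measurable_pi_iff.2 fun i => ?_
      by_cases h : i.1 = 0
      · simp only [G, h, if_true]; fun_prop
      · simp only [G, h, if_false]; fun_prop
    have hGshift : ∀ ω : Traj S A, Preorder.frestrictLe (π := fun _ => (ℝ × S) × A) n ω.shift =
        G (Preorder.frestrictLe (n + 1) ω) := by
      intro ω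
      funext i
      obtain ⟨i, hi⟩ := i
      cases i <;> rfl
    -- `chain` reads only the state and the action of the last entry, so resetting the reward in
    -- entry 0 does not affect it.
    have hker : (M.chain κ).comap
        (fun h : (i : Finset.Iic (n + 1)) → (ℝ × S) × A => h ⟨n + 1, Finset.mem_Iic.2 le_rfl⟩)
        (measurable_pi_apply _) =
        ((M.chain κ).comap (fun h : (i : Finset.Iic n) → (ℝ × S) × A =>
          h ⟨n, Finset.mem_Iic.2 le_rfl⟩) (measurable_pi_apply _)).comap G hG := by
      ext h : 1
      cases n <;> rfl
    rw [Measure.map_map (by fun_prop) (by fun_prop), Measure.map_map (by fun_prop) (by fun_prop)]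
    have e1 : ((fun x : Traj S A => (Preorder.frestrictLe (π := fun _ => (ℝ × S) × A) n x,
        x (n + 1))) ∘ Traj.shift) =
        Prod.map G id ∘ fun x => (Preorder.frestrictLe (n + 1) x, x (n + 1 + 1)) := by
      funext ω
      exact Prod.ext (hGshift ω) rfl
    have e2 : (Preorder.frestrictLe (π := fun _ => (ℝ × S) × A) n ∘ Traj.shift) =
        G ∘ Preorder.frestrictLe (n + 1) := funext hGshift
    rw [e1, e2, ← Measure.map_map (by fun_prop) (by fun_prop),
      ← Measure.map_map (by fun_prop) (by fun_prop), hstep (n + 1), hker,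
      Measure.compProd_comap_map_prodMap_id]

/-- The law of the state-action pair after one step is that of a state with an action drawn from
the policy. -/
theorem pairKernel_comp (M : MDP S A) (κ : Kernel S A) [IsMarkovKernel κ] (m : Measure (S × A))
    [IsProbabilityMeasure m] :
    M.pairKernel κ ∘ₘ m = (M.step.snd ∘ₘ m) ⊗ₘ κ := by
  ext s hs
  rw [Measure.bind_apply hs (Kernel.aemeasurable _), Measure.compProd_apply hs,
    Measure.lintegral_bind (Kernel.aemeasurable _)
      (Kernel.measurable_kernel_prodMk_left hs).aemeasurable]
  refine lintegral_congr fun x => ?_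
  rw [pairKernel, Kernel.map_apply' _ (by fun_prop) _ hs,
    Kernel.compProd_apply (hs.preimage (by fun_prop)), Kernel.snd_apply,
    lintegral_map (Kernel.measurable_kernel_prodMk_left hs) (by fun_prop)]
  rfl

/-- After at least one step the current action has been drawn from the policy, even if the first
pair had an arbitrary law. The state law is only asserted to exist, since its form plays no role
later. -/
theorem trajLaw_map_iterate_shift (M : MDP S A) (κ : Kernel S A) [IsMarkovKernel κ]
    (m : Measure (S × A)) [IsProbabilityMeasure m] (t : ℕ) :
    ∃ μ : Measure S, IsProbabilityMeasure μ ∧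
      (M.trajLaw κ m).map Traj.shift^[t + 1] = M.trajLawFrom κ μ := by
  induction t with
  | zero =>
    refine ⟨M.step.snd ∘ₘ m, inferInstance, ?_⟩
    rw [zero_add, Function.iterate_one, trajLaw_map_shift, pairKernel_comp, trajLawFrom]
  | succ t ih =>
    obtain ⟨μ, hμ, h⟩ := ih
    refine ⟨M.step.snd ∘ₘ (μ ⊗ₘ κ), inferInstance, ?_⟩
    rw [Function.iterate_succ', ← Measure.map_map (by fun_prop)
      (Traj.measurable_shift.iterate _), h, trajLawFrom, trajLaw_map_shift, pairKernel_comp,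
      trajLawFrom]

theorem trajLawFrom_map_iterate_shift (M : MDP S A) (κ : Kernel S A) [IsMarkovKernel κ]
    (μ₀ : Measure S) [IsProbabilityMeasure μ₀] (t : ℕ) :
    ∃ μ : Measure S, IsProbabilityMeasure μ ∧
      (M.trajLawFrom κ μ₀).map Traj.shift^[t] = M.trajLawFrom κ μ := by
  cases t with
  | zero => exact ⟨μ₀, inferInstance, by simp⟩
  | succ t => exact M.trajLaw_map_iterate_shift κ _ t

end MDP

/-! ### Discounted returns and value functions. -/

namespace MDP

open Filter Topology

variable {S A : Type*} [MeasurableSpace S] [MeasurableSpace A]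

section Return

variable (M : MDP S A)

/-- The absolute discounted return from time `n` on, discounted to time `0`. -/
noncomputable def absTail (n : ℕ) (ω : Traj S A) : ℝ≥0∞ :=
  ∑' l : ℕ, ENNReal.ofReal (M.γ ^ (l + n) * |ω.reward (l + n)|)

/-- The discounted return from time `n` on, discounted to time `0`. -/
noncomputable def tailReturn (n : ℕ) (ω : Traj S A) : ℝ :=
  ∑' l : ℕ, M.γ ^ (l + n) * ω.reward (l + n)

@[fun_prop]
theorem measurable_absTail (n : ℕ) : Measurable (M.absTail n) :=
  Measurable.tsum fun l => by fun_prop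

@[fun_prop]
theorem measurable_tailReturn (n : ℕ) : Measurable (M.tailReturn n) :=
  Measurable.tsum fun l => by fun_prop

@[fun_prop]
theorem measurable_discountedReturn : Measurable M.discountedReturn :=
  M.measurable_tailReturn 0

theorem absTail_antitone : Antitone fun n => M.absTail n := by
  refine antitone_nat_of_succ_le fun n ω => ?_
  simp only [absTail]
  have := ENNReal.tsum_comp_le_tsum_of_injective (f := Nat.succ) Nat.succ_injective
    fun l => ENNReal.ofReal (M.γ ^ (l + n) * |ω.reward (l + n)|)
  refine le_trans (le_of_eq (tsum_congr fun l => ?_)) this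
  rw [Nat.succ_eq_add_one, show l + 1 + n = l + (n + 1) by ring]

theorem enorm_pow_mul_reward (n : ℕ) (ω : Traj S A) :
    ‖M.γ ^ n * ω.reward n‖ₑ = ENNReal.ofReal (M.γ ^ n * |ω.reward n|) := by
  rw [← ofReal_norm, norm_mul, norm_pow, Real.norm_of_nonneg M.γ_nonneg, Real.norm_eq_abs]

theorem enorm_pow_mul_reward_le (n : ℕ) (ω : Traj S A) :
    ‖M.γ ^ n * ω.reward n‖ₑ ≤ M.absTail 0 ω := by
  rw [enorm_pow_mul_reward]
  exact ENNReal.le_tsum (f := fun l => ENNReal.ofReal (M.γ ^ (l + 0) * |ω.reward (l + 0)|)) n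

theorem enorm_tailReturn_le (n : ℕ) (ω : Traj S A) : ‖M.tailReturn n ω‖ₑ ≤ M.absTail n ω := by
  refine enorm_tsum_le_tsum_enorm.trans_eq (tsum_congr fun l => ?_)
  exact M.enorm_pow_mul_reward _ _

theorem absTail_iterate_shift (n : ℕ) (ω : Traj S A) :
    ENNReal.ofReal (M.γ ^ n) * M.absTail 0 (Traj.shift^[n] ω) = M.absTail n ω := by
  rw [absTail, ← ENNReal.tsum_mul_left, absTail]
  refine tsum_congr fun l => ?_
  rw [← ENNReal.ofReal_mul (pow_nonneg M.γ_nonneg _), Traj.iterate_shift_reward,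
    add_zero, add_comm n l, pow_add]
  ring_nf

theorem tailReturn_iterate_shift (n : ℕ) (ω : Traj S A) :
    M.γ ^ n * M.discountedReturn (Traj.shift^[n] ω) = M.tailReturn n ω := by
  rw [discountedReturn, ← tsum_mul_left, tailReturn]
  refine tsum_congr fun l => ?_
  rw [Traj.iterate_shift_reward, add_comm n l, pow_add]
  ring

theorem summable_rewards {ω : Traj S A} (h : M.absTail 0 ω ≠ ∞) :
    Summable fun l => M.γ ^ l * ω.reward l := by
  refine Summable.of_norm (tsum_enorm_ne_top_iff_summable_norm.1 ?_)
  simp only [enorm_pow_mul_reward]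
  exact h

theorem tailReturn_eq_add {ω : Traj S A} (h : M.absTail 0 ω ≠ ∞) (n : ℕ) :
    M.tailReturn n ω = M.γ ^ n * ω.reward n + M.tailReturn (n + 1) ω := by
  have hs : Summable fun l => M.γ ^ (l + n) * ω.reward (l + n) :=
    (summable_nat_add_iff n).2 (M.summable_rewards h)
  rw [tailReturn, hs.tsum_eq_zero_add, tailReturn]
  simp only [zero_add, show ∀ l, l + 1 + n = l + (n + 1) by intro l; ring]

/-- By Tonelli these integrals are the tails of a convergent series of expectations. This makes the
boundary term vanish at lam = 1. -/
theorem tendsto_lintegral_absTail {P : Measure (Traj S A)} (h : ∫⁻ ω, M.absTail 0 ω ∂P ≠ ∞) :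
    Tendsto (fun n => ∫⁻ ω, M.absTail n ω ∂P) atTop (𝓝 0) := by
  have e : ∀ n, ∫⁻ ω, M.absTail n ω ∂P =
      ∑' l, ∫⁻ ω, ENNReal.ofReal (M.γ ^ (l + n) * |ω.reward (l + n)|) ∂P := fun n =>
    lintegral_tsum fun l => by fun_prop
  simp only [e]
  exact ENNReal.tendsto_sum_nat_add
    (fun l => ∫⁻ ω, ENNReal.ofReal (M.γ ^ l * |ω.reward l|) ∂P) (by rw [e] at h; exact h)

end Return

section Value

variable (M : MDP S A) (κ : Kernel S A) [IsMarkovKernel κ]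

/-- The kernel that draws a trajectory from its initial state. -/
noncomputable def stateTrajKernel : Kernel S (Traj S A) :=
  M.trajKernel κ ∘ₖ (Kernel.id ×ₖ κ)

instance : IsMarkovKernel (M.stateTrajKernel κ) := by
  unfold stateTrajKernel; infer_instance

theorem trajLawFrom_eq_comp (μ : Measure S) [SFinite μ] :
    M.trajLawFrom κ μ = M.stateTrajKernel κ ∘ₘ μ := by
  rw [trajLawFrom, trajLaw_eq_comp, Measure.compProd_eq_comp_prod, Measure.comp_assoc,
    stateTrajKernel]

theorem trajLawFrom_dirac (s : S) :
    M.trajLawFrom κ (Measure.dirac s) = M.stateTrajKernel κ s := by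
  rw [trajLawFrom_eq_comp, Measure.dirac_bind (Kernel.measurable _)]

theorem V_eq_integral (s : S) :
    M.V κ s = ∫ ω, M.discountedReturn ω ∂(M.stateTrajKernel κ s) := by
  rw [V, trajLawFrom_dirac]

theorem Q_eq_integral (s : S) (a : A) :
    M.Q κ s a = ∫ ω, M.discountedReturn ω ∂(M.trajKernel κ (s, a)) := by
  rw [Q, trajLaw_dirac]

@[fun_prop]
theorem measurable_V : Measurable (M.V κ) := by
  have h : M.V κ = fun s => ∫ ω, M.discountedReturn ω ∂(M.stateTrajKernel κ s) :=
    funext (M.V_eq_integral κ)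
  rw [h]
  exact M.measurable_discountedReturn.stronglyMeasurable.integral_kernel.measurable

@[fun_prop]
theorem measurable_Q : Measurable fun x : S × A => M.Q κ x.1 x.2 := by
  simp only [Q_eq_integral]
  exact M.measurable_discountedReturn.stronglyMeasurable.integral_kernel.measurable

theorem trajLawFrom_map_state_zero (μ : Measure S) [IsProbabilityMeasure μ] :
    (M.trajLawFrom κ μ).map (fun ω => ω.state 0) = μ := by
  have h : (fun ω : Traj S A => ω.state 0) = Prod.fst ∘ fun ω => ω.pair 0 := rfl
  rw [h, ← Measure.map_map (by fun_prop) (by fun_prop), trajLawFrom, trajLaw_map_pair_zero]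
  exact Measure.fst_compProd _ _

/-- The first pair has a Dirac law. Points of `S × A` need not be measurable, so the equality is
obtained only after a measurable map into a space with measurable singletons. -/
theorem ae_trajKernel_pair_zero {E : Type*} [MeasurableSpace E] [MeasurableSingletonClass E]
    {g : S × A → E} (hg : Measurable g) (x : S × A) :
    ∀ᵐ ω ∂(M.trajKernel κ x), g (ω.pair 0) = g x := by
  have h : (M.trajKernel κ x).map (fun ω => g (ω.pair 0)) = Measure.dirac (g x) := by
    have e : (fun ω : Traj S A => g (ω.pair 0)) = g ∘ fun ω => ω.pair 0 := rfl
    rw [e, ← Measure.map_map hg (by fun_prop), ← trajLaw_dirac, trajLaw_map_pair_zero,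
      Measure.map_dirac' hg]
  refine ae_of_ae_map (f := fun ω : Traj S A => g (ω.pair 0)) (p := fun y => y = g x)
    (by fun_prop) ?_
  rw [h]
  exact (ae_dirac_iff (measurableSet_singleton (g x))).2 rfl

/-- Against the law of the state, `V^π` has the same integral as the return and is dominated by
the absolute return. -/
theorem integral_V {μ : Measure S} [IsProbabilityMeasure μ]
    (h : ∫⁻ ω, M.absTail 0 ω ∂(M.trajLawFrom κ μ) ≠ ∞) :
    Integrable (fun ω => M.V κ (ω.state 0)) (M.trajLawFrom κ μ) ∧
    ∫ ω, M.V κ (ω.state 0) ∂(M.trajLawFrom κ μ) =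
      ∫ ω, M.discountedReturn ω ∂(M.trajLawFrom κ μ) ∧
    ∫⁻ ω, ‖M.V κ (ω.state 0)‖ₑ ∂(M.trajLawFrom κ μ) ≤
      ∫⁻ ω, M.absTail 0 ω ∂(M.trajLawFrom κ μ) := by
  have hbound : ∫⁻ ω, ‖M.V κ (ω.state 0)‖ₑ ∂(M.trajLawFrom κ μ) ≤
      ∫⁻ ω, M.absTail 0 ω ∂(M.trajLawFrom κ μ) := by
    rw [← lintegral_map (f := fun s => ‖M.V κ s‖ₑ) (g := fun ω : Traj S A => ω.state 0)
      (by fun_prop) (by fun_prop), trajLawFrom_map_state_zero, trajLawFrom_eq_comp,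
      Measure.lintegral_bind (Kernel.aemeasurable _) (by fun_prop)]
    -- V is a conditional mean of the return, so its absolute value is at most the conditional mean
    -- of the absolute return.
    refine lintegral_mono fun s => ?_
    rw [V_eq_integral]
    exact (enorm_integral_le_lintegral_enorm _).trans
      (lintegral_mono (M.enorm_tailReturn_le 0))
  have hR : Integrable M.discountedReturn (M.trajLawFrom κ μ) :=
    ⟨(M.measurable_tailReturn 0).aestronglyMeasurable,
      (lintegral_mono (M.enorm_tailReturn_le 0)).trans_lt h.lt_top⟩
  refine ⟨⟨Measurable.aestronglyMeasurable (by fun_prop), hbound.trans_lt h.lt_top⟩, ?_, hbound⟩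
  rw [← integral_map (f := fun s => M.V κ s) (φ := fun ω : Traj S A => ω.state 0)
    (by fun_prop) (by fun_prop), trajLawFrom_map_state_zero]
  simp only [V_eq_integral]
  rw [trajLawFrom_eq_comp] at hR ⊢
  rw [Measure.comp_eq_comp_const_apply] at hR ⊢
  rw [Kernel.integral_comp hR, Kernel.const_apply]

/-- This is the Markov property at time n + 1 combined with `integral_V`. Time 0 is excluded: there
the action is fixed to be that of x, and the mean return is Q rather than V. -/
theorem integral_pow_mul_V {x : S × A} (h : ∫⁻ ω, M.absTail 0 ω ∂(M.trajKernel κ x) ≠ ∞) (n : ℕ) :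
    Integrable (fun ω => M.γ ^ (n + 1) * M.V κ (ω.state (n + 1))) (M.trajKernel κ x) ∧
    ∫ ω, M.γ ^ (n + 1) * M.V κ (ω.state (n + 1)) ∂(M.trajKernel κ x) =
      ∫ ω, M.tailReturn (n + 1) ω ∂(M.trajKernel κ x) ∧
    ∫⁻ ω, ‖M.γ ^ (n + 1) * M.V κ (ω.state (n + 1))‖ₑ ∂(M.trajKernel κ x) ≤
      ∫⁻ ω, M.absTail (n + 1) ω ∂(M.trajKernel κ x) := by
  have hstate : ∀ ω : Traj S A, ω.state (n + 1) = (Traj.shift^[n + 1] ω).state 0 := fun ω => by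
    rw [Traj.iterate_shift_state, add_zero]
  have hmeas : Measurable (Traj.shift^[n + 1] : Traj S A → Traj S A) :=
    Traj.measurable_shift.iterate _
  have htail : ∫⁻ ω, M.absTail (n + 1) ω ∂(M.trajKernel κ x) = ENNReal.ofReal (M.γ ^ (n + 1)) *
      ∫⁻ ω, M.absTail 0 (Traj.shift^[n + 1] ω) ∂(M.trajKernel κ x) := by
    rw [← lintegral_const_mul _ (by fun_prop)]
    exact lintegral_congr fun ω => (M.absTail_iterate_shift _ _).symm
  have htail' : ∫ ω, M.tailReturn (n + 1) ω ∂(M.trajKernel κ x) =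
      ∫ ω, M.γ ^ (n + 1) * M.discountedReturn (Traj.shift^[n + 1] ω) ∂(M.trajKernel κ x) :=
    integral_congr_ae (.of_forall fun ω => (M.tailReturn_iterate_shift (n + 1) ω).symm)
  rw [htail, htail']
  -- If γ = 0 every term vanishes. Otherwise γ^(n+1) can be divided out, which makes the expected
  -- absolute return of the shifted trajectory finite.
  rcases M.γ_nonneg.eq_or_lt with h0 | hpos
  · simp [← h0]
  obtain ⟨μ, hμ, hlaw⟩ := M.trajLaw_map_iterate_shift κ (Measure.dirac x) n
  rw [trajLaw_dirac] at hlaw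
  have hc : ENNReal.ofReal (M.γ ^ (n + 1)) ≠ 0 := by simpa using pow_pos hpos (n + 1)
  have hlt : ∫⁻ ω, M.absTail 0 ω ∂(M.trajLawFrom κ μ) ≠ ∞ := by
    rw [← hlaw, lintegral_map (by fun_prop) hmeas]
    intro htop
    refine h (top_unique ?_)
    calc ∞ = ∫⁻ ω, M.absTail (n + 1) ω ∂(M.trajKernel κ x) := by
          rw [htail, htop, ENNReal.mul_top hc]
      _ ≤ _ := lintegral_mono (M.absTail_antitone (Nat.zero_le _))
  obtain ⟨h1, h2, h3⟩ := M.integral_V κ hlt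
  rw [← hlaw] at h1 h2 h3
  rw [integral_map hmeas.aemeasurable (Measurable.aestronglyMeasurable (by fun_prop)),
    integral_map hmeas.aemeasurable M.measurable_discountedReturn.aestronglyMeasurable] at h2
  rw [lintegral_map (by fun_prop) hmeas, lintegral_map (by fun_prop) hmeas] at h3
  simp only [hstate]
  refine ⟨(h1.comp_measurable hmeas).const_mul _, ?_, ?_⟩
  · rw [integral_const_mul, integral_const_mul, h2]
  · simp only [enorm_mul]
    rw [lintegral_const_mul _ (by fun_prop), Real.enorm_of_nonneg (by positivity)]
    gcongr

end Value

end MDP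

/-! ### The conditional mean of GAE. -/

namespace MDP

open Filter Topology

variable {S A : Type*} [MeasurableSpace S] [MeasurableSpace A]

@[fun_prop]
theorem measurable_valueResidual (M : MDP S A) (κ : Kernel S A) [IsMarkovKernel κ] (n : ℕ) :
    Measurable fun ω : Traj S A => valueResidual M.γ (M.V κ) ω n := by
  unfold valueResidual; fun_prop

@[fun_prop]
theorem measurable_gae (M : MDP S A) (κ : Kernel S A) [IsMarkovKernel κ] (lam : ℝ) (t : ℕ) :
    Measurable fun ω : Traj S A => gae M.γ lam (M.V κ) t ω :=
  Measurable.tsum fun l => by fun_prop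

variable (M : MDP S A) (κ : Kernel S A) [IsMarkovKernel κ] {x : S × A}

theorem integrable_pow_mul_V (h : ∫⁻ ω, M.absTail 0 ω ∂(M.trajKernel κ x) ≠ ∞) (n : ℕ) :
    Integrable (fun ω => M.γ ^ n * M.V κ (ω.state n)) (M.trajKernel κ x) := by
  cases n with
  | zero =>
    refine (integrable_const (M.V κ x.1)).congr ?_
    filter_upwards [M.ae_trajKernel_pair_zero κ (g := fun y => M.V κ y.1) (by fun_prop) x] with ω hω
    rw [pow_zero, one_mul]
    exact hω.symm
  | succ n => exact (M.integral_pow_mul_V κ h n).1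

theorem integrable_tailReturn (h : ∫⁻ ω, M.absTail 0 ω ∂(M.trajKernel κ x) ≠ ∞) (n : ℕ) :
    Integrable (M.tailReturn n) (M.trajKernel κ x) :=
  ⟨(M.measurable_tailReturn n).aestronglyMeasurable,
    (lintegral_mono fun ω => (M.enorm_tailReturn_le n ω).trans
      (M.absTail_antitone (Nat.zero_le n) ω)).trans_lt h.lt_top⟩

theorem integral_V_state_zero :
    ∫ ω, M.V κ (ω.state 0) ∂(M.trajKernel κ x) = M.V κ x.1 := by
  refine (integral_congr_ae
    (M.ae_trajKernel_pair_zero κ (g := fun y => M.V κ y.1) (by fun_prop) x)).trans ?_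
  simp

theorem integral_tailReturn_zero :
    ∫ ω, M.tailReturn 0 ω ∂(M.trajKernel κ x) = M.Q κ x.1 x.2 :=
  (M.Q_eq_integral κ x.1 x.2).symm

theorem ae_absTail_ne_top (h : ∫⁻ ω, M.absTail 0 ω ∂(M.trajKernel κ x) ≠ ∞) :
    ∀ᵐ ω ∂(M.trajKernel κ x), M.absTail 0 ω ≠ ∞ :=
  (ae_lt_top (M.measurable_absTail 0) h).mono fun _ => LT.lt.ne

theorem pow_mul_valueResidual (n : ℕ) (ω : Traj S A) :
    M.γ ^ n * valueResidual M.γ (M.V κ) ω n = M.γ ^ n * ω.reward n +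
      M.γ ^ (n + 1) * M.V κ (ω.state (n + 1)) - M.γ ^ n * M.V κ (ω.state n) := by
  rw [valueResidual]; ring

theorem integrable_pow_mul_reward (h : ∫⁻ ω, M.absTail 0 ω ∂(M.trajKernel κ x) ≠ ∞) (n : ℕ) :
    Integrable (fun ω => M.γ ^ n * ω.reward n) (M.trajKernel κ x) :=
  ⟨Measurable.aestronglyMeasurable (by fun_prop),
    (lintegral_mono (M.enorm_pow_mul_reward_le n)).trans_lt h.lt_top⟩

/-- The reward term is the difference of two consecutive tail returns, and at positive times the
discounted V averages to the tail return, so all cancels for n ≥ 1. At n = 0 the tail return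
averages to Q while V(s_0) is deterministic. -/
theorem integral_pow_mul_valueResidual (h : ∫⁻ ω, M.absTail 0 ω ∂(M.trajKernel κ x) ≠ ∞) (n : ℕ) :
    ∫ ω, M.γ ^ n * valueResidual M.γ (M.V κ) ω n ∂(M.trajKernel κ x) =
      if n = 0 then M.Q κ x.1 x.2 - M.V κ x.1 else 0 := by
  have hr : ∫ ω, M.γ ^ n * ω.reward n ∂(M.trajKernel κ x) =
      ∫ ω, M.tailReturn n ω ∂(M.trajKernel κ x) -
        ∫ ω, M.tailReturn (n + 1) ω ∂(M.trajKernel κ x) := by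
    rw [← integral_sub (M.integrable_tailReturn κ h n) (M.integrable_tailReturn κ h (n + 1))]
    refine integral_congr_ae ?_
    filter_upwards [M.ae_absTail_ne_top κ h] with ω hω
    rw [M.tailReturn_eq_add hω n]; ring
  have hadd : Integrable (fun ω => M.γ ^ n * ω.reward n +
      M.γ ^ (n + 1) * M.V κ (ω.state (n + 1))) (M.trajKernel κ x) :=
    (M.integrable_pow_mul_reward κ h n).add (M.integrable_pow_mul_V κ h (n + 1))
  simp only [pow_mul_valueResidual]
  rw [integral_sub hadd (M.integrable_pow_mul_V κ h n), integral_add (M.integrable_pow_mul_reward κ h n)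
    (M.integrable_pow_mul_V κ h (n + 1)), hr, (M.integral_pow_mul_V κ h n).2.1]
  cases n with
  | zero =>
    simp only [pow_zero, one_mul, integral_V_state_zero, integral_tailReturn_zero, if_true]; ring
  | succ n => rw [(M.integral_pow_mul_V κ h n).2.1]; simp

/-- The bound is uniform in n, so for lam < 1 the powers of lam alone make the series of L¹ norms
converge. -/
theorem lintegral_pow_mul_V_le (h : ∫⁻ ω, M.absTail 0 ω ∂(M.trajKernel κ x) ≠ ∞) (n : ℕ) :
    ∫⁻ ω, ‖M.γ ^ n * M.V κ (ω.state n)‖ₑ ∂(M.trajKernel κ x) ≤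
      ∫⁻ ω, M.absTail 0 ω ∂(M.trajKernel κ x) + ‖M.V κ x.1‖ₑ := by
  cases n with
  | zero =>
    have e := lintegral_congr_ae (M.ae_trajKernel_pair_zero κ (g := fun y => ‖M.V κ y.1‖ₑ)
      (by fun_prop) x)
    simp only [pow_zero, one_mul]
    refine le_trans (le_of_eq e) ?_
    simp
  | succ n =>
    refine (M.integral_pow_mul_V κ h n).2.2.trans (le_add_right ?_)
    exact lintegral_mono (M.absTail_antitone (Nat.zero_le _))

/-- From a state-action pair with finite expected absolute return, the estimator `GAE(γ, lam)` is
integrable and its mean is the advantage. -/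
theorem integral_gae (h : ∫⁻ ω, M.absTail 0 ω ∂(M.trajKernel κ x) ≠ ∞) {lam : ℝ} (h0 : 0 ≤ lam)
    (h1 : lam ≤ 1) (hs : ∀ᵐ ω ∂(M.trajKernel κ x),
      Summable fun l : ℕ => (M.γ * lam) ^ l * valueResidual M.γ (M.V κ) ω (0 + l)) :
    Integrable (gae M.γ lam (M.V κ) 0) (M.trajKernel κ x) ∧
      ∫ ω, gae M.γ lam (M.V κ) 0 ω ∂(M.trajKernel κ x) = M.Q κ x.1 x.2 - M.V κ x.1 := by
  -- For lam < 1 a geometric bound permits exchanging sum and integral; for lam = 1 that bound is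
  -- lost and telescoping replaces it.
  rcases h1.lt_or_eq with h1 | rfl
  · set F : ℕ → Traj S A → ℝ := fun l ω => (M.γ * lam) ^ l * valueResidual M.γ (M.V κ) ω (0 + l)
      with hF
    have hF' : ∀ l ω, F l ω = lam ^ l * (M.γ ^ l * valueResidual M.γ (M.V κ) ω l) := by
      intro l ω; simp only [hF, zero_add, mul_pow]; ring
    have hFm : ∀ l, Measurable (F l) := fun l => by simp only [hF]; fun_prop
    set C : ℝ≥0∞ := ∫⁻ ω, M.absTail 0 ω ∂(M.trajKernel κ x) +
      (∫⁻ ω, M.absTail 0 ω ∂(M.trajKernel κ x) + ‖M.V κ x.1‖ₑ) +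
      (∫⁻ ω, M.absTail 0 ω ∂(M.trajKernel κ x) + ‖M.V κ x.1‖ₑ) with hC
    have hCtop : C ≠ ∞ := by simp [hC, h]
    have hbound : ∀ l, ∫⁻ ω, ‖F l ω‖ₑ ∂(M.trajKernel κ x) ≤ ENNReal.ofReal lam ^ l * C := by
      intro l
      simp only [hF', enorm_mul _ (M.γ ^ _ * _), enorm_pow, Real.enorm_of_nonneg h0]
      rw [lintegral_const_mul _ (by fun_prop)]
      gcongr
      calc ∫⁻ ω, ‖M.γ ^ l * valueResidual M.γ (M.V κ) ω l‖ₑ ∂(M.trajKernel κ x)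
          ≤ ∫⁻ ω, (‖M.γ ^ l * ω.reward l‖ₑ + ‖M.γ ^ (l + 1) * M.V κ (ω.state (l + 1))‖ₑ +
              ‖M.γ ^ l * M.V κ (ω.state l)‖ₑ) ∂(M.trajKernel κ x) := by
            refine lintegral_mono fun ω => ?_
            rw [pow_mul_valueResidual]
            refine enorm_sub_le.trans ?_
            gcongr
            exact enorm_add_le _ _
        _ ≤ C := by
            rw [lintegral_add_left (by fun_prop), lintegral_add_left (by fun_prop)]
            refine add_le_add (add_le_add ?_ ?_) ?_
            · exact lintegral_mono (M.enorm_pow_mul_reward_le l)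
            · exact M.lintegral_pow_mul_V_le κ h (l + 1)
            · exact M.lintegral_pow_mul_V_le κ h l
    have htsum : ∑' l, ∫⁻ ω, ‖F l ω‖ₑ ∂(M.trajKernel κ x) ≠ ∞ := by
      refine ne_top_of_le_ne_top ?_ (ENNReal.tsum_le_tsum hbound)
      rw [ENNReal.tsum_mul_right, ENNReal.tsum_geometric]
      refine ENNReal.mul_ne_top (ENNReal.inv_ne_top.2 ?_) hCtop
      exact (tsub_pos_of_lt (by simpa using h1)).ne'
    refine ⟨⟨(M.measurable_gae κ lam 0).aestronglyMeasurable, ?_⟩, ?_⟩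
    · refine lt_of_le_of_lt ?_ htsum.lt_top
      rw [← lintegral_tsum fun l => (hFm l).enorm.aemeasurable]
      exact lintegral_mono fun ω => enorm_tsum_le_tsum_enorm
    · have e : ∀ l, ∫ ω, F l ω ∂(M.trajKernel κ x) =
          if l = 0 then M.Q κ x.1 x.2 - M.V κ x.1 else 0 := by
        intro l
        simp only [hF']
        rw [integral_const_mul, M.integral_pow_mul_valueResidual κ h]
        split_ifs with hl
        · simp [hl]
        · simp
      refine (integral_tsum (fun l => (hFm l).aestronglyMeasurable) htsum).trans ?_
      simp only [e, tsum_ite_eq]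
  · have hpart : ∀ (K : ℕ) (ω : Traj S A), ∑ l ∈ Finset.range K,
        (M.γ * 1) ^ l * valueResidual M.γ (M.V κ) ω (0 + l) =
        ∑ l ∈ Finset.range K, M.γ ^ l * ω.reward l + M.γ ^ K * M.V κ (ω.state K) -
          M.V κ (ω.state 0) := by
      intro K ω
      induction K with
      | zero => simp
      | succ K ih =>
        rw [Finset.sum_range_succ, ih, Finset.sum_range_succ, mul_one, zero_add,
          pow_mul_valueResidual]
        ring
    -- `Z` is the limit of the boundary term γ^K V(s_K), read off from the telescoped partial sums.
    set Z : Traj S A → ℝ := fun ω =>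
      gae M.γ 1 (M.V κ) 0 ω - M.tailReturn 0 ω + M.V κ (ω.state 0) with hZ
    have hlim : ∀ᵐ ω ∂(M.trajKernel κ x),
        Tendsto (fun K => M.γ ^ K * M.V κ (ω.state K)) atTop (𝓝 (Z ω)) := by
      filter_upwards [hs, M.ae_absTail_ne_top κ h] with ω hω1 hω2
      have t1 := hω1.hasSum.tendsto_sum_nat
      have t2 := (M.summable_rewards hω2).hasSum.tendsto_sum_nat
      refine ((t1.sub t2).add_const (M.V κ (ω.state 0))).congr fun K => ?_
      rw [hpart]; ring
    have hzero : eLpNorm Z 1 (M.trajKernel κ x) = 0 := by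
      -- Fatou: the boundary terms converge to `Z` almost surely and to 0 in L¹, so `Z` is null. The
      -- index is shifted by one because the tail bound holds at positive times.
      refine le_antisymm ((Lp.eLpNorm_lim_le_liminf_eLpNorm
        (fun K => Measurable.aestronglyMeasurable (by fun_prop)) Z hlim).trans ?_) zero_le
      refine le_of_eq (Tendsto.liminf_eq ?_)
      rw [← tendsto_add_atTop_iff_nat 1]
      refine tendsto_of_tendsto_of_tendsto_of_le_of_le tendsto_const_nhds
        ((M.tendsto_lintegral_absTail h).comp (tendsto_add_atTop_nat 1))
        (fun _ => zero_le) fun K => ?_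
      simp only [eLpNorm_one_eq_lintegral_enorm]
      exact (M.integral_pow_mul_V κ h K).2.2
    have hZm : Measurable Z := by simp only [hZ]; fun_prop
    have hZ0 : Z =ᵐ[M.trajKernel κ x] 0 :=
      (eLpNorm_eq_zero_iff hZm.aestronglyMeasurable one_ne_zero).1 hzero
    have hV := M.integrable_pow_mul_V κ h 0
    simp only [pow_zero, one_mul] at hV
    have heq : (fun ω => M.tailReturn 0 ω - M.V κ (ω.state 0)) =ᵐ[M.trajKernel κ x]
        gae M.γ 1 (M.V κ) 0 := by
      filter_upwards [hZ0] with ω hω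
      simp only [hZ, Pi.zero_apply] at hω
      linarith
    have hR := M.integrable_tailReturn κ h 0
    refine ⟨(hR.sub hV).congr heq, ?_⟩
    rw [← integral_congr_ae heq, integral_sub hR hV, integral_V_state_zero,
      integral_tailReturn_zero]

end MDP

/-! ### Conditional variance decomposition in [0, ∞]. -/

section Variance

variable {Ω X E : Type*} [MeasurableSpace Ω] [MeasurableSpace X]

theorem vecVariance_map [NormedAddCommGroup E] [NormedSpace ℝ E] [MeasurableSpace E] [BorelSpace E]
    [SecondCountableTopology E] {P : Measure Ω} {φ : Ω → X} (hφ : Measurable φ) {f : X → E}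
    (hf : Measurable f) : vecVariance f (P.map φ) = vecVariance (fun ω => f (φ ω)) P := by
  rw [vecVariance, vecVariance, integral_map hφ.aemeasurable hf.aestronglyMeasurable,
    lintegral_map (by fun_prop) hφ]

/-- On a finite measure, L² is contained in L¹. The centre is arbitrary, so the default value 0 of
the mean of a non-integrable function does no harm. -/
theorem lintegral_enorm_sub_sq_eq_top [NormedAddCommGroup E] {P : Measure Ω} [IsFiniteMeasure P]
    {f : Ω → E} (hf : AEStronglyMeasurable f P) (hint : ¬ Integrable f P) (c : E) :
    ∫⁻ ω, ‖f ω - c‖ₑ ^ 2 ∂P = ∞ := by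
  by_contra h
  refine hint ?_
  have hL : MemLp (fun ω => f ω - c) 2 P := by
    refine ⟨hf.sub aestronglyMeasurable_const, ?_⟩
    rw [eLpNorm_lt_top_iff_lintegral_rpow_enorm_lt_top two_ne_zero ENNReal.ofNat_ne_top]
    simpa using (lt_top_iff_ne_top.2 h)
  refine ((hL.integrable one_le_two).add (integrable_const c)).congr (.of_forall fun ω => ?_)
  simp

variable [NormedAddCommGroup E] [InnerProductSpace ℝ E]

/-- Bias-variance decomposition for a random multiple of a fixed vector. -/
theorem lintegral_enorm_smul_sub_sq {P : Measure Ω} [IsProbabilityMeasure P] {Y : Ω → ℝ}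
    (hm : Measurable Y) (hY : Integrable Y P) (u c : E) :
    ∫⁻ ω, ‖Y ω • u - c‖ₑ ^ 2 ∂P =
      ‖u‖ₑ ^ 2 * ∫⁻ ω, ‖Y ω - ∫ ω', Y ω' ∂P‖ₑ ^ 2 ∂P + ‖(∫ ω, Y ω ∂P) • u - c‖ₑ ^ 2 := by
  set q := ∫ ω, Y ω ∂P with hq
  -- For u = 0 the product with a possibly infinite variance is 0 · ∞ = 0; for u ≠ 0 an infinite
  -- variance must force the left side to be infinite.
  rcases eq_or_ne u 0 with rfl | hu
  · simp
  have hu' : ‖u‖ₑ ^ 2 ≠ 0 := by simpa using hu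
  by_cases hfin : ∫⁻ ω, ‖Y ω - q‖ₑ ^ 2 ∂P = ∞
  · rw [hfin, ENNReal.mul_top hu', top_add]
    by_contra h
    have hL : MemLp (fun ω => Y ω • u - c) 2 P := by
      refine ⟨(hm.aestronglyMeasurable.smul_const u).sub aestronglyMeasurable_const, ?_⟩
      rw [eLpNorm_lt_top_iff_lintegral_rpow_enorm_lt_top two_ne_zero ENNReal.ofNat_ne_top]
      simpa using (lt_top_iff_ne_top.2 h)
    have hL' : MemLp (fun ω => (Y ω - q) • u) 2 P := by
      refine (hL.add (memLp_const (c - q • u))).congr_norm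
        ((hm.sub_const q).aestronglyMeasurable.smul_const u) (.of_forall fun ω => ?_)
      congr 1
      simp only [Pi.add_apply, sub_smul]; abel
    have h2 := hL'.2
    rw [eLpNorm_lt_top_iff_lintegral_rpow_enorm_lt_top two_ne_zero ENNReal.ofNat_ne_top] at h2
    simp only [ENNReal.toReal_ofNat, ENNReal.rpow_ofNat, enorm_smul, mul_pow] at h2
    rw [lintegral_mul_const _ (by fun_prop), hfin, ENNReal.top_mul hu'] at h2
    exact lt_irrefl _ h2
  · have hL : MemLp (fun ω => Y ω - q) 2 P := by
      refine ⟨(hm.sub_const q).aestronglyMeasurable, ?_⟩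
      rw [eLpNorm_lt_top_iff_lintegral_rpow_enorm_lt_top two_ne_zero ENNReal.ofNat_ne_top]
      simpa using (lt_top_iff_ne_top.2 hfin)
    have hsq : Integrable (fun ω => (Y ω - q) ^ 2) P := hL.integrable_sq
    have hc : Integrable (fun ω => Y ω - q) P := hY.sub (integrable_const q)
    have hc0 : ∫ ω, (Y ω - q) ∂P = 0 := by
      rw [integral_sub hY (integrable_const q)]; simp [hq]
    set w := q • u - c with hw
    have hexp : ∀ ω, ‖Y ω • u - c‖ ^ 2 =
        ‖u‖ ^ 2 * (Y ω - q) ^ 2 + 2 * inner ℝ u w * (Y ω - q) + ‖w‖ ^ 2 := by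
      intro ω
      have e : Y ω • u - c = (Y ω - q) • u + w := by rw [hw, sub_smul]; abel
      rw [e, norm_add_sq_real, norm_smul, inner_smul_left, mul_pow, Real.norm_eq_abs, sq_abs]
      simp only [conj_trivial]
      ring
    have hofR : ∀ v : E, ‖v‖ₑ ^ 2 = ENNReal.ofReal (‖v‖ ^ 2) := fun v => by
      rw [← ofReal_norm, ENNReal.ofReal_pow (norm_nonneg _)]
    have hofR' : ∀ y : ℝ, ‖y‖ₑ ^ 2 = ENNReal.ofReal (y ^ 2) := fun y => by
      rw [← ofReal_norm, ← ENNReal.ofReal_pow (norm_nonneg _), Real.norm_eq_abs, sq_abs]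
    have i1 : Integrable (fun ω => ‖u‖ ^ 2 * (Y ω - q) ^ 2 + 2 * inner ℝ u w * (Y ω - q)) P :=
      (hsq.const_mul _).add (hc.const_mul _)
    have i2 : Integrable (fun ω => ‖Y ω • u - c‖ ^ 2) P := by
      simp only [hexp]
      exact i1.add (integrable_const _)
    simp only [hofR, hofR']
    rw [← ofReal_integral_eq_lintegral_ofReal i2 (.of_forall fun ω => by positivity),
      ← ofReal_integral_eq_lintegral_ofReal hsq (.of_forall fun ω => by positivity),
      ← ENNReal.ofReal_mul (by positivity), ← ENNReal.ofReal_add (mul_nonneg (by positivity)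
        (integral_nonneg fun ω => by positivity)) (by positivity)]
    congr 1
    simp only [hexp]
    rw [integral_add i1 (integrable_const _), integral_add (hsq.const_mul _) (hc.const_mul _),
      integral_const_mul, integral_const_mul, hc0]
    simp

variable [MeasurableSpace E] [BorelSpace E] [SecondCountableTopology E]

/-- Conditional variance decomposition of a random multiple `Y • U` of a random vector `U` that
is determined by the conditioning variable. -/
theorem vecVariance_smul_comp [CompleteSpace E] {m : Measure X} [IsProbabilityMeasure m]
    {T : Kernel X Ω} [IsMarkovKernel T] {Y : Ω → ℝ} (hY : Measurable Y) {U : Ω → E}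
    (hU : Measurable U) {u : X → E} (hu : Measurable u) (hUu : ∀ x, ∀ᵐ ω ∂(T x), U ω = u x)
    {q : X → ℝ} (hq : Measurable q)
    (hint : ∀ᵐ x ∂m, Integrable Y (T x) ∧ ∫ ω, Y ω ∂(T x) = q x) :
    vecVariance (fun ω => Y ω • U ω) (T ∘ₘ m) =
      ∫⁻ x, ‖u x‖ₑ ^ 2 * ∫⁻ ω, ‖Y ω - q x‖ₑ ^ 2 ∂(T x) ∂m + vecVariance (fun x => q x • u x) m := by
  have hYU : Measurable fun ω => Y ω • U ω := hY.smul hU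
  have hqu : Measurable fun x => q x • u x := hq.smul hu
  have key : ∀ c : E, ∫⁻ ω, ‖Y ω • U ω - c‖ₑ ^ 2 ∂(T ∘ₘ m) =
      ∫⁻ x, ‖u x‖ₑ ^ 2 * ∫⁻ ω, ‖Y ω - q x‖ₑ ^ 2 ∂(T x) ∂m + ∫⁻ x, ‖q x • u x - c‖ₑ ^ 2 ∂m := by
    intro c
    rw [Measure.lintegral_bind (Kernel.aemeasurable _) (by fun_prop),
      ← lintegral_add_right _ (by fun_prop)]
    refine lintegral_congr_ae ?_
    filter_upwards [hint] with x hx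
    rw [← hx.2, ← lintegral_enorm_smul_sub_sq hY hx.1]
    refine lintegral_congr_ae ?_
    filter_upwards [hUu x] with ω hω
    rw [hω]
  by_cases hi : Integrable (fun ω => Y ω • U ω) (T ∘ₘ m)
  · have hmean : ∫ ω, Y ω • U ω ∂(T ∘ₘ m) = ∫ x, q x • u x ∂m := by
      rw [Measure.comp_eq_comp_const_apply] at hi ⊢
      rw [Kernel.integral_comp hi, Kernel.const_apply]
      refine integral_congr_ae ?_
      filter_upwards [hint] with x hx
      rw [← hx.2, ← integral_smul_const]
      refine integral_congr_ae ?_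
      filter_upwards [hUu x] with ω hω
      rw [hω]
    rw [vecVariance, key, hmean, vecVariance]
  -- Without integrability the means may disagree, but `key` at the mean of q • u turns the right
  -- side into a second moment of Y • U about that point, and both sides are ∞.
  · rw [vecVariance, vecVariance, ← key,
      lintegral_enorm_sub_sq_eq_top hYU.aestronglyMeasurable hi,
      lintegral_enorm_sub_sq_eq_top hYU.aestronglyMeasurable hi]

end Variance

/-- Summability in ℝ is absolute, so it says that a measurable [0, ∞]-valued sum is finite. This
lets almost sure convergence pass through the pushforward by the shift. -/
theorem measurableSet_summable_real {Ω : Type*} [MeasurableSpace Ω] {f : ℕ → Ω → ℝ}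
    (hf : ∀ n, Measurable (f n)) : MeasurableSet {ω | Summable fun n => f n ω} := by
  have h : {ω | Summable fun n => f n ω} = {ω | ∑' n, ‖f n ω‖ₑ ≠ ∞} := by
    ext ω
    simp only [Set.mem_ofPred_eq]
    rw [tsum_enorm_ne_top_iff_summable_norm, summable_norm_iff]
  rw [h]
  exact (Measurable.tsum fun n => (hf n).enorm) (measurableSet_singleton ∞).compl

/-! ### Relation between the two estimators. -/

section Estimators

variable {S A : Type*}

theorem gae_iterate_shift (γ lam : ℝ) (V : S → ℝ) (t : ℕ) (ω : Traj S A) :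
    gae γ lam V 0 (Traj.shift^[t] ω) = gae γ lam V t ω := by
  simp only [gae, valueResidual, Traj.iterate_shift_state, Traj.iterate_shift_reward, zero_add,
    add_assoc]

theorem uae_iterate_shift (γ lam : ℝ) (Ψ : S → A → ℝ) (b : S → ℝ) (t : ℕ) (ω : Traj S A) :
    uae γ lam Ψ b 0 (Traj.shift^[t] ω) = uae γ lam Ψ b t ω := by
  simp only [uae, baseResidual, correction, Traj.iterate_shift_state, Traj.iterate_shift_reward,
    Traj.iterate_shift_action, zero_add, add_zero, add_assoc]

/-- With the bootstrapped value `V`, the estimator `UAE(γ, lam)` is `GAE(γ, lam)` with the baseline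
`V` replaced by `b` in the first residual. -/
theorem uae_value_eq_gae_add (γ lam : ℝ) (V b : S → ℝ) {t : ℕ} {ω : Traj S A}
    (hs : Summable fun l : ℕ => (γ * lam) ^ l * valueResidual γ V ω (t + l)) :
    uae γ lam (fun s _ => V s) b t ω =
      gae γ lam V t ω + (V (ω.state t) - b (ω.state t)) := by
  rw [uae, gae, hs.tsum_eq_zero_add]
  have e : ∀ l, baseResidual γ (fun s (_ : A) => V s) b ω l - correction (fun s _ => V s) b ω l =
      valueResidual γ V ω l := fun l => by
    simp only [baseResidual, correction, valueResidual]; ring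
  simp only [e]
  simp only [baseResidual, valueResidual, pow_zero, add_zero]
  ring

end Estimators

/-! ### Comparison of the variances. -/

namespace MDP

variable {S A : Type*} [MeasurableSpace S] [MeasurableSpace A]

theorem measurable_uae (M : MDP S A) (κ : Kernel S A) [IsMarkovKernel κ] (lam : ℝ) {b : S → ℝ}
    (hb : Measurable b) (t : ℕ) :
    Measurable fun ω : Traj S A => uae M.γ lam (fun s _ => M.V κ s) b t ω := by
  unfold uae baseResidual correction
  exact Measurable.add (by fun_prop) (Measurable.tsum fun l => by fun_prop)

theorem ae_lintegral_absTail_ne_top (M : MDP S A) (κ : Kernel S A) [IsMarkovKernel κ]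
    (μ : Measure S) [SFinite μ]
    (h : ∀ s, ∫⁻ ω, M.absTail 0 ω ∂(M.trajLawFrom κ (Measure.dirac s)) < ∞) :
    ∀ᵐ x ∂(μ ⊗ₘ κ), ∫⁻ ω, M.absTail 0 ω ∂(M.trajKernel κ x) ≠ ∞ := by
  have hm : Measurable fun x => ∫⁻ ω, M.absTail 0 ω ∂(M.trajKernel κ x) :=
    (M.measurable_absTail 0).lintegral_kernel
  refine Measure.ae_compProd_of_ae_ae (hm (measurableSet_singleton ∞).compl) (.of_forall fun s => ?_)
  have hs := h s
  rw [trajLawFrom, trajLaw_eq_comp, Measure.lintegral_bind (Kernel.aemeasurable _) (by fun_prop),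
    Measure.lintegral_compProd hm, lintegral_dirac' _ (by fun_prop)] at hs
  exact (ae_lt_top (by fun_prop) hs.ne).mono fun _ => LT.lt.ne

/-- Comparison of the two estimators for trajectories whose first state-action pair has law
`μ ⊗ κ`. -/
theorem vecVariance_uae_le_gae (M : MDP S A) (κ : Kernel S A) [IsMarkovKernel κ] {E : Type*}
    [NormedAddCommGroup E] [InnerProductSpace ℝ E] [CompleteSpace E] [MeasurableSpace E]
    [BorelSpace E] [SecondCountableTopology E] {lam : ℝ} (h0 : 0 ≤ lam) (h1 : lam ≤ 1)
    {m : Measure (S × A)} [IsProbabilityMeasure m]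
    (hreturn : ∀ᵐ x ∂m, ∫⁻ ω, M.absTail 0 ω ∂(M.trajKernel κ x) ≠ ∞)
    (hseries : ∀ᵐ ω ∂(M.trajLaw κ m),
      Summable fun l : ℕ => (M.γ * lam) ^ l * valueResidual M.γ (M.V κ) ω (0 + l))
    {u : S × A → E} (hu : Measurable u) {b : S → ℝ} (hb : Measurable b)
    (hbaseline : vecVariance (fun x => (M.Q κ x.1 x.2 - b x.1) • u x) m ≤
      vecVariance (fun x => (M.Q κ x.1 x.2 - M.V κ x.1) • u x) m) :
    vecVariance (fun ω => uae M.γ lam (fun s _ => M.V κ s) b 0 ω • u (ω.pair 0)) (M.trajLaw κ m) ≤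
      vecVariance (fun ω => gae M.γ lam (M.V κ) 0 ω • u (ω.pair 0)) (M.trajLaw κ m) := by
  rw [trajLaw_eq_comp] at hseries ⊢
  have hgae : ∀ᵐ x ∂m, Integrable (gae M.γ lam (M.V κ) 0) (M.trajKernel κ x) ∧
      ∫ ω, gae M.γ lam (M.V κ) 0 ω ∂(M.trajKernel κ x) = M.Q κ x.1 x.2 - M.V κ x.1 := by
    filter_upwards [hreturn, Measure.ae_ae_of_ae_comp hseries] with x hx hx'
    exact M.integral_gae κ hx h0 h1 hx'
  have huae : ∀ᵐ x ∂m, ∀ᵐ ω ∂(M.trajKernel κ x), uae M.γ lam (fun s _ => M.V κ s) b 0 ω =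
      gae M.γ lam (M.V κ) 0 ω + (M.V κ x.1 - b x.1) := by
    filter_upwards [Measure.ae_ae_of_ae_comp hseries] with x hx
    filter_upwards [hx, M.ae_trajKernel_pair_zero κ (g := fun y => M.V κ y.1 - b y.1)
      (by fun_prop) x] with ω hω hω'
    rw [uae_value_eq_gae_add _ _ _ _ hω, ← hω']
    rfl
  have huae' : ∀ᵐ x ∂m,
      Integrable (uae M.γ lam (fun s _ => M.V κ s) b 0) (M.trajKernel κ x) ∧
      ∫ ω, uae M.γ lam (fun s _ => M.V κ s) b 0 ω ∂(M.trajKernel κ x) =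
        M.Q κ x.1 x.2 - b x.1 := by
    filter_upwards [huae, hgae] with x hx hx'
    refine ⟨(hx'.1.add (integrable_const _)).congr (hx.mono fun ω hω => hω.symm), ?_⟩
    rw [integral_congr_ae hx, integral_add hx'.1 (integrable_const _), hx'.2]
    simp
  have hU : ∀ x, ∀ᵐ ω ∂(M.trajKernel κ x), u (ω.pair 0) = u x :=
    M.ae_trajKernel_pair_zero κ hu
  rw [vecVariance_smul_comp (M.measurable_uae κ lam hb 0) (by fun_prop) hu hU (by fun_prop) huae',
    vecVariance_smul_comp (M.measurable_gae κ lam 0) (by fun_prop) hu hU (by fun_prop) hgae]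
  -- Given x, the two estimators differ by a constant, so their deviations from their conditional
  -- means coincide.
  refine add_le_add (le_of_eq (lintegral_congr_ae ?_)) hbaseline
  filter_upwards [huae] with x hx
  congr 1
  refine lintegral_congr_ae ?_
  filter_upwards [hx] with ω hω
  rw [hω]
  congr 2
  ring

end MDP

theorem mainTheorem2 {S A : Type*} [MeasurableSpace S] [MeasurableSpace A]
    (ν : Measure A) [SFinite ν] {d : ℕ}
    (M : MDP S A) (π : ParamPolicy d S A ν) (θ : EuclideanSpace ℝ (Fin d))
    (lam : ℝ) (hlam0 : 0 ≤ lam) (hlam1 : lam ≤ 1) (t : ℕ)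
    -- the value functions are well defined: absolutely convergent expected return from each state
    (hreturn : ∀ s : S, ∫⁻ ω, ∑' l : ℕ, ENNReal.ofReal (M.γ ^ l * |ω.reward l|)
      ∂(M.trajLawFrom (π.kernel θ) (Measure.dirac s)) < ∞)
    -- the series that defines the estimators converges almost surely
    (hseries : ∀ᵐ ω ∂(M.trajLawFrom (π.kernel θ) M.init),
      Summable fun l : ℕ => (M.γ * lam) ^ l * valueResidual M.γ (M.V (π.kernel θ)) ω (t + l))
    -- the score exists at the sampled state-action pair, and is measurable
    (hscore_diff : ∀ᵐ ω ∂(M.trajLawFrom (π.kernel θ) M.init),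
      DifferentiableAt ℝ (fun ϑ => Real.log (π.density ϑ (ω.state t) (ω.action t))) θ)
    (hscore_meas : Measurable fun x : S × A => π.score θ x.1 x.2)
    (b : S → ℝ) (hb : Measurable b)
    -- the baseline `b` reduces the variance of the policy gradient at least as much as `V^π`
    (hbaseline :
      vecVariance (fun ω => (M.Q (π.kernel θ) (ω.state t) (ω.action t) - b (ω.state t)) •
          π.score θ (ω.state t) (ω.action t)) (M.trajLawFrom (π.kernel θ) M.init) ≤
      vecVariance (fun ω => (M.Q (π.kernel θ) (ω.state t) (ω.action t)
            - M.V (π.kernel θ) (ω.state t)) •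
          π.score θ (ω.state t) (ω.action t)) (M.trajLawFrom (π.kernel θ) M.init)) :
    vecVariance (fun ω => uae M.γ lam (fun s _ => M.V (π.kernel θ) s) b t ω •
        π.score θ (ω.state t) (ω.action t)) (M.trajLawFrom (π.kernel θ) M.init) ≤
    vecVariance (fun ω => gae M.γ lam (M.V (π.kernel θ)) t ω •
        π.score θ (ω.state t) (ω.action t)) (M.trajLawFrom (π.kernel θ) M.init) := by
  set κ := π.kernel θ
  have hshift : Measurable (Traj.shift^[t] : Traj S A → Traj S A) :=
    Traj.measurable_shift.iterate t
  obtain ⟨μ, hμ, hlaw⟩ := M.trajLawFrom_map_iterate_shift κ M.init t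
  have hpair : (M.trajLawFrom κ μ).map (fun ω => ω.pair 0) = μ ⊗ₘ κ :=
    M.trajLaw_map_pair_zero κ (μ ⊗ₘ κ)
  have hpairt : ∀ ω : Traj S A,
      (Traj.shift^[t] ω).pair 0 = (ω.state t, ω.action t) := fun ω => by
    rw [Traj.pair, Traj.iterate_shift_state, Traj.iterate_shift_action, add_zero]
  -- The baseline hypothesis involves only the pair at time t, whose law is μ ⊗ κ.
  have hpolicy : ∀ f : S × A → EuclideanSpace ℝ (Fin d), Measurable f →
      vecVariance f (μ ⊗ₘ κ) =
        vecVariance (fun ω => f (ω.state t, ω.action t)) (M.trajLawFrom κ M.init) := by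
    intro f hf
    rw [← hpair, vecVariance_map (by fun_prop) hf, ← hlaw,
      vecVariance_map (f := fun ω => f (ω.pair 0)) hshift (hf.comp (Traj.measurable_pair 0))]
    simp only [hpairt]
  have hmain := M.vecVariance_uae_le_gae κ hlam0 hlam1 (m := μ ⊗ₘ κ)
    (M.ae_lintegral_absTail_ne_top κ μ hreturn)
    (by
      change ∀ᵐ ω ∂(M.trajLawFrom κ μ), _
      rw [← hlaw, ae_map_iff hshift.aemeasurable
        (measurableSet_summable_real fun l => by fun_prop)]
      filter_upwards [hseries] with ω hω
      simpa only [valueResidual, Traj.iterate_shift_state, Traj.iterate_shift_reward, zero_add,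
        add_assoc] using hω)
    hscore_meas hb
    (by
      rw [hpolicy _ (Measurable.fun_smul (by fun_prop) hscore_meas),
        hpolicy _ (Measurable.fun_smul (by fun_prop) hscore_meas)]
      exact hbaseline)
  change vecVariance _ (M.trajLawFrom κ μ) ≤ vecVariance _ (M.trajLawFrom κ μ) at hmain
  have hscore : Measurable fun ω : Traj S A => π.score θ (ω.pair 0).1 (ω.pair 0).2 :=
    hscore_meas.comp (Traj.measurable_pair 0)
  rw [← hlaw, vecVariance_map hshift (Measurable.fun_smul (M.measurable_uae κ lam hb 0) hscore),
    vecVariance_map hshift (Measurable.fun_smul (M.measurable_gae κ lam 0) hscore)] at hmain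
  simpa only [uae_iterate_shift, gae_iterate_shift, hpairt] using hmain
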